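/- **Theorem 5.8.** Let $\Sigma$ be a signature (a set of operation symbols with arities in $\mathbb{N}$), $V$ a set of variables, and $t_1=t_2$ an equation between $\Sigma$-terms over $V$ that is *2-discerning*. Let $(T,\eta,\mu)$ be a monoidal monad on $\mathbf{Set}$, with structure maps $\psi_{X,Y}\colon TX\times TY\to T(X\times Y)$. Then $T$ is relevant if and only if $T$ preserves $t_1=t_2$. Here: - *2-discerning* means that, up to exchanging the names of $t_1$ and $t_2$: the same variables occur in $t_1$ and in $t_2$ (the equation is non-drop); every variable occurs at most once in $t_1$; there is exactly one variable $x$ that occurs more than once in $t_2$, and it occurs there exactly twice (so the equation is 2-dup); and, letting $x'$ be a fresh variable, $s$ a term obtained from $t_2$ by renaming one of the two occurrences of $x$ to $x'$, and $s'$ the term obtained from $s$ by exchanging $x$ and $x'$, the linear equation $s=s'$ is not derivable from $t_1=t_2$ in equational logic, i.e. $(s,s')$ is not in the least congruence on $\Sigma$-terms over $V\cup\{x'\}$ containing all substitution instances of $t_1=t_2$. (There are two choices of $s$, interchanged by swapping $x$ and $x'$, so the choice is irrelevant.) - A *monoidal monad* is a monad whose underlying functor is lax monoidal for the cartesian product,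 via $\psi$ and $\psi^0\colon 1\to T1$, and whose unit and multiplication are monoidal natural transformations (in particular $\psi^0=\eta_1$). - $T$ is *relevant* if $\psi_{A,A}\circ\Delta_{TA}=T\Delta_A$ for every set $A$, where $\Delta_A\colon A\to A\times A$, $a\mapsto(a,a)$. - For a $\Sigma$-algebra $\mathcal{A}$ with carrier $A$, the lifted algebra $\widehat{T}\mathcal{A}$ has carrier $TA$, and an $n$-ary symbol $\sigma$ is interpreted in it as $(TA)^n\xrightarrow{\psi^n}T(A^n)\xrightarrow{T\sigma_{\mathcal{A}}}TA$, where $\psi^n$ is the $n$-ary iterate of $\psi$. The monad $T$ *preserves* $t_1=t_2$ if, for every $\Sigma$-algebra $\mathcal{A}$ satisfying $t_1=t_2$, the algebra $\widehat{T}\mathcal{A}$ also satisfies $t_1=t_2$. -/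

import Mathlib

universe u

namespace MonadPreservation

open CategoryTheory MonoidalCategory

/-! ### Signatures, terms, equations -/

/-- A (finitary, one-sorted) signature: a set of operation symbols, each with a natural number
as its arity. -/
structure Signature : Type (u + 1) where
  Op : Type u
  arity : Op → ℕ

/-- The set of terms over the signature `S` with variables in `V`. -/
inductive Term (S : Signature.{u}) (V : Type u) : Type u
  | var (v : V) : Term S V
  | app (f : S.Op) (ts : Fin (S.arity f) → Term S V) : Term S V

namespace Term

variable {S : Signature.{u}} {V W : Type u}

/-- Simultaneous substitution of terms for variables. -/
def subst (σ : V → Term S W) : Term S V → Term S W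
  | var v => σ v
  | app f ts => app f (fun i => (ts i).subst σ)

/-- Renaming of variables (not necessarily injective). -/
def rename (r : V → W) (t : Term S V) : Term S W :=
  t.subst (fun v => var (r v))

open Classical in
/-- The number of occurrences of the variable `v` in a term. -/
noncomputable def occ (v : V) : Term S V → ℕ
  | var w => if w = v then 1 else 0
  | app _ ts => ∑ i, (ts i).occ v

/-- The set of variables appearing in a term. -/
def vars (t : Term S V) : Set V := {v | 0 < t.occ v}

end Term

section Equations

variable {S : Signature.{u}} {V W : Type u}

/-- `Derivable E t t'`: the equation `t = t'` (in variables from `W`) is provable in equational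
logic from the axioms `E` (in variables from `V`), i.e. `t` and `t'` are related by the least
congruence on terms over `W` containing all substitution instances of the axioms. -/
inductive Derivable (E : Set (Term S V × Term S V)) : Term S W → Term S W → Prop
  | ax (t t' : Term S V) (h : (t, t') ∈ E) (σ : V → Term S W) :
      Derivable E (t.subst σ) (t'.subst σ)
  | refl (t : Term S W) : Derivable E t t
  | symm {t t' : Term S W} : Derivable E t t' → Derivable E t' t
  | trans {t t' t'' : Term S W} : Derivable E t t' → Derivable E t' t'' → Derivable E t t''
  | congr (f : S.Op) (ts ts' : Fin (S.arity f) → Term S W) :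
      (∀ i, Derivable E (ts i) (ts' i)) → Derivable E (Term.app f ts) (Term.app f ts')

/-- Both sides have the same variables, each occurring exactly once on each side. -/
def IsLinear (t₁ t₂ : Term S V) : Prop :=
  t₁.vars = t₂.vars ∧ ∀ v ∈ t₁.vars, t₁.occ v = 1 ∧ t₂.occ v = 1

/-- At least one variable appears on one side but not on the other. -/
def IsDrop (t₁ t₂ : Term S V) : Prop :=
  ∃ v, (v ∈ t₁.vars ∧ v ∉ t₂.vars) ∨ (v ∈ t₂.vars ∧ v ∉ t₁.vars)

/-- At least one variable appears more than once in one of the sides. -/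
def IsDup (t₁ t₂ : Term S V) : Prop :=
  ∃ v, 1 < t₁.occ v ∨ 1 < t₂.occ v

/-- A dup equation in which each variable appears at most twice in each side. -/
def IsTwoDup (t₁ t₂ : Term S V) : Prop :=
  IsDup t₁ t₂ ∧ ∀ v, t₁.occ v ≤ 2 ∧ t₂.occ v ≤ 2

/-- Identify the extra variable `none` with `x`; all other variables are kept. -/
def merge (x : V) : Option V → V
  | none => x
  | some v => v

open Classical in
/-- Exchange the extra variable `none` with `x`; all other variables are kept. -/
noncomputable def exchange (x : V) : Option V → Option V :=
  Equiv.swap none (some x)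

/-- `t₁ = t₂` is 2-discerning with the duplication on the right: it is a 2-dup non-drop equation,
exactly one variable `x` is duplicated, and only in `t₂`; moreover, if `s` is the term obtained
from `t₂` by renaming one of the two occurrences of `x` to a fresh variable `x'` (here: `none`),
and `s'` is obtained from `s` by exchanging `x` and `x'`, then the linear equation `s = s'` is not
derivable from `t₁ = t₂`.  (There are two choices for `s`, exchanged with one another by swapping
`x` and `x'`, so that the choice does not matter.) -/
def IsTwoDiscerningRight (t₁ t₂ : Term S V) : Prop :=
  IsTwoDup t₁ t₂ ∧ ¬ IsDrop t₁ t₂ ∧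
    ∃ x : V, (∀ v, t₁.occ v ≤ 1) ∧ (∀ v, 1 < t₂.occ v ↔ v = x) ∧
      ∃ s : Term S (Option V),
        IsLinear s (s.rename (exchange x)) ∧
        s.rename (merge x) = t₂ ∧
        ¬ Derivable {(t₁, t₂)} s (s.rename (exchange x))

/-- `t₁ = t₂` is 2-discerning: the duplication may be on either side. -/
def IsTwoDiscerning (t₁ t₂ : Term S V) : Prop :=
  IsTwoDiscerningRight t₁ t₂ ∨ IsTwoDiscerningRight t₂ t₁

end Equations

/-! ### Algebras -/

/-- An algebra structure for the signature `S` on the carrier `A`. -/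
structure AlgebraOn (S : Signature.{u}) (A : Type u) : Type u where
  op (f : S.Op) : (Fin (S.arity f) → A) → A

namespace AlgebraOn

variable {S : Signature.{u}} {V A : Type u}

/-- The interpretation of a term in an algebra under a valuation of the variables. -/
def eval (𝒜 : AlgebraOn S A) (ρ : V → A) : Term S V → A
  | Term.var v => ρ v
  | Term.app f ts => 𝒜.op f (fun i => 𝒜.eval ρ (ts i))

/-- The algebra satisfies the equation `t₁ = t₂`. -/
def Satisfies (𝒜 : AlgebraOn S A) (t₁ t₂ : Term S V) : Prop :=
  ∀ ρ : V → A, 𝒜.eval ρ t₁ = 𝒜.eval ρ t₂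

end AlgebraOn

/-! ### Monoidal monads on the category of sets -/

/-- A monoidal monad on the category of sets (with its cartesian monoidal structure): the
underlying functor is lax monoidal, and unit and multiplication are monoidal natural
transformations.  In particular the unit constraint `1 → T 1` is the unit of the monad. -/
class MonoidalMonad (T : Monad (Type u)) extends T.toFunctor.LaxMonoidal where
  unit_isMonoidal : NatTrans.IsMonoidal T.η
  mul_isMonoidal : NatTrans.IsMonoidal T.μ

section Lifting

variable (T : Monad (Type u)) [MonoidalMonad T]

/-- The binary map `ψ : T X × T Y → T (X × Y)`. -/
def psi (X Y : Type u) (p : T.obj X × T.obj Y) : T.obj (X × Y) :=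
  Functor.LaxMonoidal.μ T.toFunctor X Y p

/-- The `n`-ary map `ψⁿ : (T A)ⁿ → T (Aⁿ)`, iterating the binary one; for `n = 0` it is the map
`1 → T 1`. -/
def psiPow (A : Type u) : (n : ℕ) → (Fin n → T.obj A) → T.obj (Fin n → A)
  | 0, _ => T.η.app (Fin 0 → A) (fun i => i.elim0)
  | n + 1, a =>
      T.map (↾(fun p : A × (Fin n → A) => (Fin.cons p.1 p.2 : Fin (n + 1) → A)))
        (psi T A (Fin n → A) (a 0, psiPow A n (Fin.tail a)))

/-- The lifting of an algebra structure on `A` to `T A`: the operation `f` is interpreted as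
`ψⁿ : (T A)ⁿ → T (Aⁿ)` followed by `T f`. -/
def lift {S : Signature.{u}} {A : Type u} (𝒜 : AlgebraOn S A) : AlgebraOn S (T.obj A) where
  op f a := T.map (↾(𝒜.op f)) (psiPow T A (S.arity f) a)

/-- `T` preserves the equation `t₁ = t₂`: whenever an algebra satisfies it, so does its lifting. -/
def Preserves {S : Signature.{u}} {V : Type u} (t₁ t₂ : Term S V) : Prop :=
  ∀ (A : Type u) (𝒜 : AlgebraOn S A), 𝒜.Satisfies t₁ t₂ → (lift T 𝒜).Satisfies t₁ t₂

/-- `T` is relevant: `ψ ∘ Δ = T Δ` as maps `T A → T (A × A)`, for every set `A`. -/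
def IsRelevant : Prop :=
  ∀ (A : Type u) (a : T.obj A), psi T A A (a, a) = T.map (↾(fun x : A => (x, x))) a

end Lifting

end MonadPreservation

/-! In Kleisli terms `psi` draws from both arguments, in either order (`bind_comm`), and relevance
says that drawing twice from `a` is the same as drawing once and copying the outcome.

For a relevant `T`, evaluating a term in the lifted algebra therefore amounts to drawing each of its
variables once and evaluating in the original algebra (`Determines.eval`); the resulting superfluous
draws disappear because the variables drawn occur in the term (`IsRelevant.absorb_eval`). Two sides
with the same variables then agree.

Conversely, preservation is tested on the free algebra over `V ⊕ X`, with `x` sent to the image of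
`a` among the generators from `X`. Let `e (p, q)` be the class of `s` with `p`, `q` in place of `x`,
`x'`. By linearity in single occurrences (`lift_eval_eq_bind`), `t₁` evaluates to `T e` of `TΔ a`
and `t₂` to `T e` of `psi (a, a)`. Non-derivability of `s = s'` makes `e` injective
(`eq_of_derivable_pairSubst`), and `T` preserves injections out of nonempty sets, so `e` can be
cancelled. -/

namespace MonadPreservation

open CategoryTheory MonoidalCategory

/-! ### Kleisli calculus of a monoidal monad on sets -/

section Kleisli

variable (T : Monad (Type u)) {X Y Z W : Type u}

/-- The unit of the monad, as a function. -/
def unit (x : X) : T.obj X := T.η.app X x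

variable {T}

/-- Kleisli extension. -/
def bind (m : T.obj X) (k : X → T.obj Y) : T.obj Y := T.μ.app Y (T.map (↾k) m)

theorem map_comp_apply (f : X ⟶ Y) (g : Y ⟶ Z) (m : T.obj X) :
    T.map g (T.map f m) = T.map (f ≫ g) m := by
  rw [T.map_comp]; rfl

theorem map_unit (f : X → Y) (x : X) : T.map (↾f) (unit T x) = unit T (f x) :=
  (ConcreteCategory.congr_hom (T.η.naturality (↾f)) x).symm

theorem map_mu (f : X → Y) (m : T.obj (T.obj X)) :
    T.map (↾f) (T.μ.app X m) = T.μ.app Y (T.map (T.map (↾f)) m) :=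
  (ConcreteCategory.congr_hom (T.μ.naturality (↾f)) m).symm

theorem unit_bind (x : X) (k : X → T.obj Y) : bind (unit T x) k = k x := by
  unfold bind
  rw [map_unit]
  exact ConcreteCategory.congr_hom (T.left_unit Y) (k x)

theorem map_eq_bind (f : X → Y) (m : T.obj X) :
    T.map (↾f) m = bind m (fun x => unit T (f x)) := by
  have h : (↾(fun x => unit T (f x)) : X ⟶ T.obj Y) = (↾f) ≫ T.η.app Y := rfl
  unfold bind
  rw [h, ← map_comp_apply]
  exact (ConcreteCategory.congr_hom (T.right_unit Y) (T.map (↾f) m)).symm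

theorem bind_unit (m : T.obj X) : bind m (unit T) = m := by
  have h := map_eq_bind (fun x => x) m
  rw [← h]
  exact ConcreteCategory.congr_hom (T.map_id X) m

theorem bind_bind (m : T.obj X) (k : X → T.obj Y) (l : Y → T.obj Z) :
    bind (bind m k) l = bind m (fun x => bind (k x) l) := by
  have h : (↾(fun x => bind (k x) l) : X ⟶ T.obj Z) = (↾k) ≫ T.map (↾l) ≫ T.μ.app Z := rfl
  unfold bind at *
  rw [h, map_mu, ← map_comp_apply, ← map_comp_apply]
  exact (ConcreteCategory.congr_hom (T.assoc Z) _).symm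

theorem mu_unit (m : T.obj X) : T.μ.app X (unit T m) = m :=
  ConcreteCategory.congr_hom (T.left_unit X) m

theorem mu_map_unit (m : T.obj X) : T.μ.app X (T.map (↾(unit T)) m) = m :=
  ConcreteCategory.congr_hom (T.right_unit X) m

variable [MonoidalMonad T]

theorem psi_map (f : X → Y) (g : Z → W) (a : T.obj X) (b : T.obj Z) :
    psi T Y W (T.map (↾f) a, T.map (↾g) b) = T.map (↾(Prod.map f g)) (psi T X Z (a, b)) :=
  ConcreteCategory.congr_hom (Functor.LaxMonoidal.μ_natural T.toFunctor (↾f) (↾g))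
    ((a, b) : T.obj X × T.obj Z)

theorem epsilon_eq :
    Functor.LaxMonoidal.ε T.toFunctor PUnit.unit = unit T (PUnit.unit : PUnit.{u + 1}) :=
  (ConcreteCategory.congr_hom (MonoidalMonad.unit_isMonoidal (T := T)).unit PUnit.unit).symm

theorem psi_mu (a : T.obj (T.obj X)) (b : T.obj (T.obj Y)) :
    psi T X Y (T.μ.app X a, T.μ.app Y b)
      = T.μ.app (X × Y) (T.map (↾(psi T X Y)) (psi T (T.obj X) (T.obj Y) (a, b))) :=
  (ConcreteCategory.congr_hom ((MonoidalMonad.mul_isMonoidal (T := T)).tensor X Y)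
    ((a, b) : T.obj (T.obj X) × T.obj (T.obj Y))).symm

/-- Unitality covers only `X = PUnit`; naturality along the constant map at `x` gives the rest. -/
theorem psi_unit_left (x : X) (b : T.obj Y) :
    psi T X Y (unit T x, b) = T.map (↾(fun y => (x, y))) b := by
  have h : psi T PUnit Y (unit T PUnit.unit, b) = T.map (↾(fun y => (PUnit.unit, y))) b := by
    rw [← epsilon_eq]
    exact ConcreteCategory.congr_hom (Functor.LaxMonoidal.left_unitality_inv T.toFunctor Y) b
  have h2 := psi_map (T := T) (fun _ : PUnit.{u + 1} => x) (fun y : Y => y) (unit T PUnit.unit) b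
  rw [map_unit, h, map_comp_apply] at h2
  have h3 : T.map (↾(fun y : Y => y)) b = b := ConcreteCategory.congr_hom (T.map_id Y) b
  rw [h3] at h2
  exact h2

theorem psi_unit_right (a : T.obj X) (y : Y) :
    psi T X Y (a, unit T y) = T.map (↾(fun x => (x, y))) a := by
  have h : psi T X PUnit (a, unit T PUnit.unit) = T.map (↾(fun x => (x, PUnit.unit))) a := by
    rw [← epsilon_eq]
    exact ConcreteCategory.congr_hom (Functor.LaxMonoidal.right_unitality_inv T.toFunctor X) a
  have h2 := psi_map (T := T) (fun x : X => x) (fun _ : PUnit.{u + 1} => y) a (unit T PUnit.unit)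
  rw [map_unit, h, map_comp_apply] at h2
  have h3 : T.map (↾(fun x : X => x)) a = a := ConcreteCategory.congr_hom (T.map_id X) a
  rw [h3] at h2
  exact h2

/-- Monoidality of the multiplication, applied to `Tη a` and `η b`, both of which multiply back to
`a` and `b`. Exchanging the two roles gives the opposite order of drawing. -/
theorem psi_eq_bind_left (a : T.obj X) (b : T.obj Y) :
    psi T X Y (a, b) = bind a (fun x => bind b (fun y => unit T (x, y))) := by
  have h := psi_mu (T.map (↾(unit T)) a) (unit T b)
  rw [mu_unit, mu_map_unit, psi_unit_right, map_comp_apply, map_comp_apply] at h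
  rw [h]
  unfold bind
  refine congrArg (fun k : X → T.obj (X × Y) => T.μ.app (X × Y) (T.map (↾k) a)) (funext fun x => ?_)
  exact (psi_unit_left x b).trans (map_eq_bind _ _)

theorem psi_eq_bind_right (a : T.obj X) (b : T.obj Y) :
    psi T X Y (a, b) = bind b (fun y => bind a (fun x => unit T (x, y))) := by
  have h := psi_mu (unit T a) (T.map (↾(unit T)) b)
  rw [mu_unit, mu_map_unit, psi_unit_left, map_comp_apply, map_comp_apply] at h
  rw [h]
  unfold bind
  refine congrArg (fun k : Y → T.obj (X × Y) => T.μ.app (X × Y) (T.map (↾k) b)) (funext fun y => ?_)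
  exact (psi_unit_right a y).trans (map_eq_bind _ _)

/-- A monoidal monad on sets is commutative. -/
theorem bind_comm (a : T.obj X) (b : T.obj Y) (k : X → Y → T.obj Z) :
    bind a (fun x => bind b (fun y => k x y)) = bind b (fun y => bind a (fun x => k x y)) := by
  have h := congrArg (fun m => bind m (fun p : X × Y => k p.1 p.2))
    ((psi_eq_bind_left a b).symm.trans (psi_eq_bind_right a b))
  simpa only [bind_bind, unit_bind] using h

/-- Out of an empty set every Kleisli map is the unit, so commuting the draws from `a` and `b` reads
`a = b`. -/
theorem obj_subsingleton [IsEmpty X] : Subsingleton (T.obj X) := by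
  refine ⟨fun a b => ?_⟩
  have h := bind_comm a b (fun x _ => (isEmptyElim x : T.obj X))
  rw [show (fun x : X => bind b fun _ => (isEmptyElim x : T.obj X)) = unit T from
      funext fun x => isEmptyElim x,
    show (fun _ : X => bind a fun x : X => (isEmptyElim x : T.obj X)) = unit T from
      funext fun x => isEmptyElim x, bind_unit, bind_unit] at h
  exact h

theorem IsRelevant.bind_dup (hT : IsRelevant T) (a : T.obj X) (k : X → X → T.obj Z) :
    bind a (fun x => bind a (fun y => k x y)) = bind a (fun x => k x x) := by
  have h := congrArg (fun m => bind m (fun p : X × X => k p.1 p.2)) (hT X a)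
  rw [psi_eq_bind_left, map_eq_bind] at h
  simpa only [bind_bind, unit_bind] using h

end Kleisli

/-! ### Terms -/

namespace Term

variable {S : Signature.{u}} {V W U : Type u}

theorem mem_vars_var {v w : V} : v ∈ (var w : Term S V).vars ↔ w = v := by
  by_cases h : w = v <;> simp [vars, occ, h]

theorem mem_vars_app {v : V} {f : S.Op} {ts : Fin (S.arity f) → Term S V} :
    v ∈ (app f ts).vars ↔ ∃ i, v ∈ (ts i).vars := by
  simp [vars, occ, Finset.sum_pos_iff]

theorem mem_vars_subst {σ : V → Term S W} {t : Term S V} {w : W} :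
    w ∈ (t.subst σ).vars ↔ ∃ v ∈ t.vars, w ∈ (σ v).vars := by
  induction t with
  | var v => simp [subst, mem_vars_var]
  | app f ts ih =>
    simp only [subst, mem_vars_app, ih]
    exact ⟨fun ⟨i, v, h⟩ => ⟨v, ⟨i, h.1⟩, h.2⟩, fun ⟨v, ⟨i, h⟩, h'⟩ => ⟨i, v, h, h'⟩⟩

theorem subst_subst (σ : V → Term S W) (τ : W → Term S U) (t : Term S V) :
    (t.subst σ).subst τ = t.subst (fun v => (σ v).subst τ) := by
  induction t with
  | var v => rfl
  | app f ts ih => simp only [subst, ih]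

theorem subst_var (t : Term S V) : t.subst var = t := by
  induction t with
  | var v => rfl
  | app f ts ih => simp only [subst, ih]

theorem occ_rename_merge (x : V) (t : Term S (Option V)) :
    (t.rename (merge x)).occ x = t.occ none + t.occ (some x) := by
  unfold rename
  induction t with
  | var v =>
    rcases v with _ | v
    · simp [subst, occ, merge]
    · by_cases h : v = x <;> simp [subst, occ, merge, h]
  | app f ts ih => simp only [subst, occ, ih, Finset.sum_add_distrib]

end Term

section Derivability

variable {S : Signature.{u}} {V W U : Type u}

theorem Derivable.subst {E : Set (Term S V × Term S V)} {t t' : Term S W} (h : Derivable E t t')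
    (τ : W → Term S U) : Derivable E (t.subst τ) (t'.subst τ) := by
  induction h with
  | ax t t' h σ =>
    rw [Term.subst_subst, Term.subst_subst]
    exact .ax _ _ h _
  | refl t => exact .refl _
  | symm _ ih => exact ih.symm
  | trans _ _ ih ih' => exact ih.trans ih'
  | congr f ts ts' _ ih => exact .congr _ _ _ ih

theorem Derivable.vars_eq {E : Set (Term S V × Term S V)} {t t' : Term S W} (h : Derivable E t t')
    (hE : ∀ e ∈ E, e.1.vars = e.2.vars) : t.vars = t'.vars := by
  induction h with
  | ax t t' h σ =>
    ext w
    rw [Term.mem_vars_subst, Term.mem_vars_subst, hE _ h]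
  | refl t => rfl
  | symm _ ih => exact ih.symm
  | trans _ _ ih ih' => exact ih.trans ih'
  | congr f ts ts' _ ih =>
    ext w
    simp only [Term.mem_vars_app, ih]

theorem vars_eq_of_not_isDrop {t₁ t₂ : Term S V} (h : ¬ IsDrop t₁ t₂) : t₁.vars = t₂.vars := by
  ext v
  by_contra hv
  exact h ⟨v, by tauto⟩

/-- Provable equality as an equivalence relation. -/
def derivableSetoid (E : Set (Term S V × Term S V)) (W : Type u) : Setoid (Term S W) where
  r := Derivable E
  iseqv := ⟨.refl, .symm, .trans⟩

/-- The free algebra on `W` of the variety axiomatised by `E`. -/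
noncomputable def freeAlgebra (E : Set (Term S V × Term S V)) (W : Type u) :
    AlgebraOn S (Quotient (derivableSetoid E W)) where
  op f a := Quotient.mk _ (Term.app f fun i => (a i).out)

theorem freeAlgebra_eval_mk (E : Set (Term S V × Term S V)) (σ : U → Term S W) (t : Term S U) :
    (freeAlgebra E W).eval (fun v => Quotient.mk _ (σ v)) t = Quotient.mk _ (t.subst σ) := by
  induction t with
  | var v => rfl
  | app f ts ih =>
    simp only [AlgebraOn.eval, ih, Term.subst]
    exact Quotient.sound (.congr _ _ _ fun i => Quotient.mk_out (s := derivableSetoid E W) _)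

theorem freeAlgebra_satisfies {E : Set (Term S V × Term S V)} {t₁ t₂ : Term S V}
    (h : (t₁, t₂) ∈ E) : (freeAlgebra E W).Satisfies t₁ t₂ := by
  intro ρ
  have hρ : ρ = fun v => Quotient.mk _ (ρ v).out := funext fun v => (ρ v).out_eq.symm
  rw [hρ, freeAlgebra_eval_mk, freeAlgebra_eval_mk]
  exact Quotient.sound (.ax _ _ h _)

end Derivability

/-! ### Evaluation of terms in algebras and in lifted algebras -/

namespace AlgebraOn

variable {S : Signature.{u}} {V W A : Type u} (𝒜 : AlgebraOn S A)

theorem eval_congr {ρ ρ' : V → A} {t : Term S V} (h : ∀ v ∈ t.vars, ρ v = ρ' v) :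
    𝒜.eval ρ t = 𝒜.eval ρ' t := by
  induction t with
  | var v => exact h v (Term.mem_vars_var.2 rfl)
  | app f ts ih =>
    simp only [eval]
    congr 1
    exact funext fun i => ih i fun v hv => h v (Term.mem_vars_app.2 ⟨i, hv⟩)

theorem eval_rename (ρ : W → A) (r : V → W) (t : Term S V) :
    𝒜.eval ρ (t.rename r) = 𝒜.eval (fun v => ρ (r v)) t := by
  unfold Term.rename
  induction t with
  | var v => rfl
  | app f ts ih => simp only [Term.subst, eval, ih]

end AlgebraOn

section LiftedAlgebra

variable {T : Monad (Type u)} {S : Signature.{u}} {V A X Y Z : Type u}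

/-- Nonemptiness supplies a left inverse, which any functor preserves. -/
theorem map_injective_of_injective [Nonempty X] {f : X → Y} (hf : Function.Injective f) :
    Function.Injective fun m : T.obj X => T.map (↾f) m := by
  obtain ⟨g, hg⟩ := hf.hasLeftInverse
  intro m m' h
  have h' := congrArg (fun m => T.map (↾g) m) h
  simpa only [map_eq_bind, bind_bind, unit_bind, hg _, bind_unit] using h'

/-- Drawing from `m` after `j` gives the value that `f` computes from the outcome of `j`. -/
def Determines (j : T.obj X) (m : T.obj Y) (f : X → Y) : Prop :=
  ∀ (Z : Type u) (k : X → Y → T.obj Z),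
    bind j (fun g => bind m (k g)) = bind j (fun g => k g (f g))

open Classical in
/-- Draw values for the variables in a list; the other variables have a default value. -/
noncomputable def sample (d : A) (ρ : V → T.obj A) : List V → T.obj (V → A)
  | [] => unit T fun _ => d
  | v :: l => bind (ρ v) fun a => bind (sample d ρ l) fun g => unit T (Function.update g v a)

theorem bind_sample_absorb (d : A) (ρ : V → T.obj A) (l : List V) (m : T.obj X)
    (h : ∀ v ∈ l, bind (ρ v) (fun _ => m) = m) : bind (sample d ρ l) (fun _ => m) = m := by
  induction l with
  | nil => rw [sample, unit_bind]
  | cons v l ih =>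
    simp only [sample, bind_bind, unit_bind]
    rw [ih fun w hw => h w (List.mem_cons_of_mem _ hw), h v List.mem_cons_self]

variable [MonoidalMonad T]

theorem psiPow_zero (a : Fin 0 → T.obj A) :
    psiPow T A 0 a = unit T (fun i : Fin 0 => i.elim0) := rfl

theorem psiPow_succ {n : ℕ} (a : Fin (n + 1) → T.obj A) :
    psiPow T A (n + 1) a = bind (a 0) fun x => bind (psiPow T A n (Fin.tail a)) fun h =>
      unit T (Fin.cons x h : Fin (n + 1) → A) := by
  rw [psiPow, map_eq_bind, psi_eq_bind_left]
  simp only [bind_bind, unit_bind]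

theorem lift_op (𝒜 : AlgebraOn S A) (f : S.Op) (a : Fin (S.arity f) → T.obj A) :
    (lift T 𝒜).op f a = bind (psiPow T A (S.arity f) a) fun h => unit T (𝒜.op f h) :=
  map_eq_bind _ _

theorem psiPow_unit {n : ℕ} (a : Fin n → A) :
    psiPow T A n (fun i => unit T (a i)) = unit T a := by
  induction n with
  | zero => rw [psiPow_zero]; congr 1; exact funext fun i => i.elim0
  | succ n ih =>
    have h := ih (Fin.tail a)
    rw [psiPow_succ, unit_bind]
    change bind (psiPow T A n fun i => unit T (Fin.tail a i)) _ = _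
    rw [h, unit_bind, Fin.cons_self_tail]

theorem lift_eval_unit (𝒜 : AlgebraOn S A) (r : V → A) (t : Term S V) :
    (lift T 𝒜).eval (fun v => unit T (r v)) t = unit T (𝒜.eval r t) := by
  induction t with
  | var v => rfl
  | app f ts ih => simp only [AlgebraOn.eval, ih, lift_op, psiPow_unit, unit_bind]

/-- Commutativity moves the draw from `m` to the front, past the coordinates before `i`. -/
theorem psiPow_bind {n : ℕ} (i : Fin n) (m : T.obj X) (a : X → Fin n → T.obj A)
    (a₀ : Fin n → T.obj A) (hi : a₀ i = bind m fun x => a x i)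
    (hne : ∀ j ≠ i, ∀ x, a x j = a₀ j) :
    psiPow T A n a₀ = bind m fun x => psiPow T A n (a x) := by
  induction n with
  | zero => exact i.elim0
  | succ n ih =>
    simp only [psiPow_succ]
    cases i using Fin.cases with
    | zero =>
      have ht : ∀ x, Fin.tail (a x) = Fin.tail a₀ := fun x =>
        funext fun j => hne j.succ (Fin.succ_ne_zero j) x
      simp only [hi, bind_bind, ht]
    | succ i =>
      have h0 : ∀ x, a x 0 = a₀ 0 := hne 0 (Fin.succ_ne_zero i).symm
      rw [ih i (fun x => Fin.tail (a x)) (Fin.tail a₀) hi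
        fun j hj x => hne j.succ (fun h => hj (Fin.succ_injective _ h)) x]
      simp only [bind_bind, h0]
      rw [bind_comm]

open Classical in
/-- Evaluation in a lifted algebra is linear in every variable that occurs exactly once. -/
theorem lift_eval_eq_bind (𝒜 : AlgebraOn S A) (R : V → T.obj A) (y : V) (t : Term S V)
    (hy : t.occ y = 1) :
    (lift T 𝒜).eval R t
      = bind (R y) fun b => (lift T 𝒜).eval (Function.update R y (unit T b)) t := by
  induction t with
  | var v =>
    have hv : v = y := by
      by_contra h
      simp [Term.occ, h] at hy
    subst hv
    simp only [AlgebraOn.eval, Function.update_self]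
    exact (bind_unit _).symm
  | app f ts ih =>
    simp only [Term.occ] at hy
    -- The counts add up to 1, so a single argument contains `y`, and the others ignore the update
    -- at `y`.
    obtain ⟨i, -, hi⟩ := Finset.sum_pos_iff.1 (hy.symm ▸ zero_lt_one :
      0 < ∑ i, (ts i).occ y)
    have hsum := Finset.add_sum_erase Finset.univ (fun i => (ts i).occ y) (Finset.mem_univ i)
    have hne := (Finset.sum_eq_zero_iff (s := Finset.univ.erase i)
      (f := fun i => (ts i).occ y)).1 (by omega)
    have hi : (ts i).occ y = 1 := by omega
    simp only [AlgebraOn.eval, lift_op]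
    rw [psiPow_bind i (R y)
      (fun b j => (lift T 𝒜).eval (Function.update R y (unit T b)) (ts j)) _ (ih i hi), bind_bind]
    intro j hj b
    refine AlgebraOn.eval_congr _ fun v hv => Function.update_of_ne ?_ _ _
    rintro rfl
    exact absurd (hne j (Finset.mem_erase.2 ⟨hj, Finset.mem_univ _⟩)) (Nat.pos_iff_ne_zero.1 hv)

/-! ### Relevant monads preserve non-drop equations -/

theorem psiPow_absorb {n : ℕ} (m : T.obj X) (a : Fin n → T.obj A) (i : Fin n)
    (h : bind m (fun _ => a i) = a i) : bind m (fun _ => psiPow T A n a) = psiPow T A n a := by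
  refine (psiPow_bind i m (fun _ => a) a h.symm fun _ _ _ => rfl).symm

/-- At the variable itself, relevance merges the discarded draw with the one being used;
`psiPow_absorb` carries this up through the operations. -/
theorem IsRelevant.absorb_eval (hT : IsRelevant T) (𝒜 : AlgebraOn S A) (ρ : V → T.obj A)
    (v : V) (t : Term S V) (hv : v ∈ t.vars) :
    bind (ρ v) (fun _ => (lift T 𝒜).eval ρ t) = (lift T 𝒜).eval ρ t := by
  induction t with
  | var w =>
    obtain rfl := Term.mem_vars_var.1 hv
    have h := hT.bind_dup (ρ w) (fun _ y => unit T y)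
    simp only [bind_unit] at h
    exact h
  | app f ts ih =>
    obtain ⟨i, hi⟩ := Term.mem_vars_app.1 hv
    simp only [AlgebraOn.eval, lift_op]
    rw [← bind_bind, psiPow_absorb _ _ i (ih i hi)]

theorem Determines.psiPow {n : ℕ} {j : T.obj X} {a : Fin n → T.obj A} {f : Fin n → X → A}
    (h : ∀ i, Determines j (a i) (f i)) :
    Determines j (psiPow T A n a) (fun g i => f i g) := by
  intro Z k
  induction n with
  | zero =>
    simp only [psiPow_zero, unit_bind]
    congr 1
    exact funext fun g => congrArg (k g) (funext fun i => i.elim0)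
  | succ n ih =>
    simp only [psiPow_succ, bind_bind, unit_bind]
    rw [h 0 Z fun g x => bind (MonadPreservation.psiPow T A n (Fin.tail a))
      fun l => k g (Fin.cons x l : Fin (n + 1) → A)]
    rw [ih (a := Fin.tail a) (f := fun i => f i.succ) (fun i => h i.succ)
      fun g l => k g (Fin.cons (f 0 g) l : Fin (n + 1) → A)]
    congr 1
    refine funext fun g => congrArg (k g) (funext fun i => ?_)
    cases i using Fin.cases <;> rfl

theorem Determines.eval {j : T.obj X} (𝒜 : AlgebraOn S A) {ρ : V → T.obj A} {r : X → V → A}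
    {t : Term S V} (h : ∀ v ∈ t.vars, Determines j (ρ v) (fun g => r g v)) :
    Determines j ((lift T 𝒜).eval ρ t) (fun g => 𝒜.eval (r g) t) := by
  induction t with
  | var v => exact h v (Term.mem_vars_var.2 rfl)
  | app f ts ih =>
    intro Z k
    simp only [AlgebraOn.eval, lift_op, bind_bind, unit_bind]
    exact Determines.psiPow (fun i => ih i fun v hv => h v (Term.mem_vars_app.2 ⟨i, hv⟩)) Z
      (fun g l => k g (𝒜.op f l))

open Classical in
theorem IsRelevant.sample_determines (hT : IsRelevant T) (d : A) (ρ : V → T.obj A) (l : List V)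
    (v : V) (hv : v ∈ l) : Determines (sample d ρ l) (ρ v) (fun g => g v) := by
  induction l with
  | nil => simp at hv
  | cons w l ih =>
    intro Z k
    simp only [sample, bind_bind, unit_bind]
    by_cases h : v = w
    · subst h
      simp only [Function.update_self]
      -- Commuted past the tail, the second draw from `ρ v` meets the first, and relevance
      -- identifies them.
      rw [← hT.bind_dup (ρ v) fun a b => bind (sample d ρ l) fun g => k (Function.update g v a) b]
      congr 1
      exact funext fun a => bind_comm _ _ _
    · have hv' : v ∈ l := by simpa [h] using hv
      congr 1
      refine funext fun a => ?_
      simp only [Function.update_of_ne h]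
      exact ih hv' Z fun g => k (Function.update g w a)

theorem Term.vars_finite (t : Term S V) : t.vars.Finite := by
  induction t with
  | var v => exact (Set.finite_singleton v).subset fun w hw => (Term.mem_vars_var.1 hw).symm
  | app f ts ih =>
    exact (Set.finite_iUnion ih).subset fun w hw => Set.mem_iUnion.2 (Term.mem_vars_app.1 hw)

theorem IsRelevant.preserves (hT : IsRelevant T) {t₁ t₂ : Term S V} (h : t₁.vars = t₂.vars) :
    Preserves T t₁ t₂ := by
  intro A 𝒜 h𝒜 ρ
  rcases isEmpty_or_nonempty A with hA | ⟨⟨d⟩⟩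
  · exact (obj_subsingleton (T := T) (X := A)).elim _ _
  -- The right-hand side depends on `t` only through its values in `𝒜`, where the equation holds.
  have key : ∀ t : Term S V, t.vars = t₁.vars → (lift T 𝒜).eval ρ t
      = bind (sample d ρ t₁.vars_finite.toFinset.toList) fun g => unit T (𝒜.eval g t) := by
    intro t ht
    have hmem : ∀ v, v ∈ t₁.vars_finite.toFinset.toList ↔ v ∈ t.vars := by simp [ht]
    have hd := Determines.eval 𝒜 (r := fun g => g) (t := t) fun v hv =>
      hT.sample_determines d ρ t₁.vars_finite.toFinset.toList v ((hmem v).2 hv)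
    rw [← hd A fun _ => unit T]
    simp only [bind_unit]
    exact (bind_sample_absorb d ρ _ _ fun v hv => hT.absorb_eval 𝒜 ρ v t ((hmem v).1 hv)).symm
  rw [key t₁ rfl, key t₂ h.symm]
  congr 1
  exact funext fun g => congrArg (unit T) (h𝒜 g)

/-! ### Preservation of a 2-discerning equation implies relevance -/

/-- The substitution sending the two special variables `none` and `some x` to generators from `X`,
and every other variable to itself. -/
noncomputable def pairSubst (S : Signature.{u}) (x : V) (p q : X) : Option V → Term S (V ⊕ X)
  | none => .var (.inr q)
  | some v => open Classical in if v = x then .var (.inr p) else .var (.inl v)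

theorem mem_vars_subst_pairSubst {x : V} {s : Term S (Option V)} (h0 : none ∈ s.vars)
    (hx : some x ∈ s.vars) (p q z : X) :
    Sum.inr z ∈ (s.subst (pairSubst S x p q)).vars ↔ z = p ∨ z = q := by
  rw [Term.mem_vars_subst]
  constructor
  · rintro ⟨_ | v, -, hz⟩
    · simp only [pairSubst, Term.mem_vars_var] at hz
      exact Or.inr (Sum.inr_injective hz).symm
    · by_cases hv : v = x
      · simp only [pairSubst, hv, if_true, Term.mem_vars_var] at hz
        exact Or.inl (Sum.inr_injective hz).symm
      · simp [pairSubst, hv, Term.mem_vars_var] at hz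
  · rintro (rfl | rfl)
    · exact ⟨some x, hx, by simp [pairSubst, Term.mem_vars_var]⟩
    · exact ⟨none, h0, by simp [pairSubst, Term.mem_vars_var]⟩

/-- Non-drop axioms preserve variable sets, so the pairs can differ only by a swap of two distinct
generators. Renaming these generators back to `x` and `x'` would then derive `s = s'`. -/
theorem eq_of_derivable_pairSubst {E : Set (Term S V × Term S V)}
    (hE : ∀ e ∈ E, e.1.vars = e.2.vars) {x : V} {s : Term S (Option V)} (h0 : none ∈ s.vars)
    (hx : some x ∈ s.vars) (hs : ¬ Derivable E s (s.rename (exchange x))) {p q p' q' : X}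
    (h : Derivable E (s.subst (pairSubst S x p q)) (s.subst (pairSubst S x p' q'))) :
    p = p' ∧ q = q' := by
  classical
  have hv : ∀ z, (z = p ∨ z = q) ↔ (z = p' ∨ z = q') := fun z => by
    rw [← mem_vars_subst_pairSubst h0 hx, ← mem_vars_subst_pairSubst h0 hx, h.vars_eq hE]
  by_contra hne
  have hswap : p ≠ q ∧ p' = q ∧ q' = p := by
    have h1 := hv p
    have h2 := hv q
    have h3 := hv p'
    have h4 := hv q'
    grind
  obtain ⟨hpq, rfl, rfl⟩ := hswap
  refine hs ?_
  have hd := h.subst (Sum.elim (fun v => .var (some v))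
    fun z => if z = q' then .var (some x) else .var none : V ⊕ X → Term S (Option V))
  rw [Term.subst_subst, Term.subst_subst] at hd
  have e1 : (fun v => (pairSubst S x q' p' v).subst (Sum.elim (fun v => .var (some v))
      fun z => if z = q' then .var (some x) else .var none : V ⊕ X → Term S (Option V)))
      = Term.var := by
    funext v
    rcases v with _ | v
    · simp [pairSubst, Term.subst, hpq.symm]
    · by_cases hv : v = x <;> simp [pairSubst, Term.subst, hv]
  have e2 : (fun v => (pairSubst S x p' q' v).subst (Sum.elim (fun v => .var (some v))
      fun z => if z = q' then .var (some x) else .var none : V ⊕ X → Term S (Option V)))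
      = fun v => Term.var (exchange x v) := by
    funext v
    rcases v with _ | v
    · simp [pairSubst, Term.subst, exchange]
    · by_cases hv : v = x
      · simp [pairSubst, Term.subst, hv, exchange, hpq.symm]
      · simp [pairSubst, Term.subst, hv, exchange, Equiv.swap_apply_of_ne_of_ne]
  rwa [e1, e2, Term.subst_var] at hd

theorem IsTwoDiscerningRight.vars_eq {t₁ t₂ : Term S V} (h : IsTwoDiscerningRight t₁ t₂) :
    t₁.vars = t₂.vars := vars_eq_of_not_isDrop h.2.1

theorem IsTwoDiscerningRight.isRelevant {t₁ t₂ : Term S V} (h : IsTwoDiscerningRight t₁ t₂)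
    (hT : Preserves T t₁ t₂) : IsRelevant T := by
  classical
  intro X a
  -- Cancelling `T e` below needs a nonempty domain.
  rcases isEmpty_or_nonempty X with hX | hX
  · exact (obj_subsingleton (T := T) (X := X × X)).elim _ _
  obtain ⟨-, -, x, h1, h2, s, hlin, hst, hder⟩ := id h
  have hmem : (t₁, t₂) ∈ ({(t₁, t₂)} : Set (Term S V × Term S V)) := rfl
  have hE : ∀ e ∈ ({(t₁, t₂)} : Set (Term S V × Term S V)), e.1.vars = e.2.vars := by
    rintro _ rfl
    exact h.vars_eq
  generalize ({(t₁, t₂)} : Set (Term S V × Term S V)) = E at hder hmem hE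
  have hle : ∀ v, s.occ v ≤ 1 := fun v => by
    by_contra hv
    have := (hlin.2 v (show 0 < s.occ v by omega)).1
    omega
  -- The duplicated variable of `t₂` splits in `s` into exactly one `some x` and one `none`.
  have hsum : 1 < s.occ none + s.occ (some x) := by
    rw [← Term.occ_rename_merge, hst]
    exact (h2 x).2 rfl
  have hs0 : s.occ none = 1 := by have := hle none; have := hle (some x); omega
  have hsx : s.occ (some x) = 1 := by have := hle none; have := hle (some x); omega
  have ht₁ : t₁.occ x = 1 := by
    have hx : x ∈ t₁.vars := h.vars_eq ▸ (show 0 < t₂.occ x from zero_lt_one.trans ((h2 x).2 rfl))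
    exact le_antisymm (h1 x) hx
  let 𝒜 := freeAlgebra E (V ⊕ X)
  let r : X → X → Option V → Quotient (derivableSetoid E (V ⊕ X)) :=
    fun p q v => Quotient.mk _ (pairSubst S x p q v)
  let e : X × X → Quotient (derivableSetoid E (V ⊕ X)) := fun p => 𝒜.eval (r p.1 p.2) s
  have he : Function.Injective e := by
    rintro ⟨p, q⟩ ⟨p', q'⟩ hpq
    simp only [e, r, 𝒜, freeAlgebra_eval_mk] at hpq
    obtain ⟨rfl, rfl⟩ := eq_of_derivable_pairSubst hE (hs0 ▸ zero_lt_one : 0 < s.occ none)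
      (hsx ▸ zero_lt_one : 0 < s.occ (some x)) hder (Quotient.exact hpq)
    rfl
  refine map_injective_of_injective he ?_
  let gen : X → Quotient (derivableSetoid E (V ⊕ X)) := fun p =>
    Quotient.mk _ (.var (.inr p))
  let ρ : V → T.obj (Quotient (derivableSetoid E (V ⊕ X))) := fun v =>
    if v = x then bind a fun p => unit T (gen p) else unit T (Quotient.mk _ (.var (.inl v)))
  have hρ := hT _ 𝒜 (freeAlgebra_satisfies hmem) ρ
  have hleft : (lift T 𝒜).eval ρ t₁ = T.map (↾e) (T.map (↾fun p : X => (p, p)) a) := by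
    have hu : ∀ p : X, Function.update ρ x (unit T (gen p))
        = fun v => unit T (r p p (some v)) := fun p => by
      funext v
      by_cases hv : v = x
      · subst hv; simp [r, pairSubst, gen]
      · simp [r, pairSubst, gen, ρ, hv]
    have hep : ∀ p : X, 𝒜.eval (fun v => r p p (some v)) t₁ = e (p, p) := fun p => by
      rw [freeAlgebra_satisfies hmem, ← hst, AlgebraOn.eval_rename]
      refine congrArg (fun ρ => 𝒜.eval ρ s) (funext fun v => ?_)
      cases v <;> simp [r, pairSubst, merge]
    rw [lift_eval_eq_bind 𝒜 ρ x t₁ ht₁]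
    simp only [ρ, if_true, bind_bind, unit_bind, map_eq_bind]
    congr 1
    funext p
    rw [← hep, ← lift_eval_unit, ← hu]
  have hright : (lift T 𝒜).eval ρ t₂ = T.map (↾e) (psi T X X (a, a)) := by
    -- Read through `s`, the two occurrences of `x` are separate variables with the same value, so
    -- each yields its own draw from `a`.
    rw [← hst, AlgebraOn.eval_rename, lift_eval_eq_bind 𝒜 _ (some x) s hsx]
    simp only [merge, ρ, if_true, bind_bind, unit_bind, map_eq_bind, psi_eq_bind_left]
    congr 1
    funext p
    rw [lift_eval_eq_bind 𝒜 _ none s hs0]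
    simp only [Function.update_of_ne, ne_eq, reduceCtorEq, not_false_eq_true, if_true,
      bind_bind, unit_bind]
    congr 1
    funext q
    rw [← lift_eval_unit]
    refine congrArg (fun ρ => (lift T 𝒜).eval ρ s) (funext fun v => ?_)
    rcases v with _ | v
    · simp [r, pairSubst, gen]
    · by_cases hv : v = x
      · subst hv; simp [r, pairSubst, gen]
      · simp [r, pairSubst, hv]
  exact hright.symm.trans (hρ.symm.trans hleft)

theorem Preserves.symm {t₁ t₂ : Term S V} (h : Preserves T t₁ t₂) : Preserves T t₂ t₁ :=
  fun A 𝒜 h𝒜 ρ => (h A 𝒜 (fun ρ => (h𝒜 ρ).symm) ρ).symm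

end LiftedAlgebra

end MonadPreservation

theorem theorem5p8 (S : MonadPreservation.Signature.{u}) (V : Type u)
    (t₁ t₂ : MonadPreservation.Term S V) (h : MonadPreservation.IsTwoDiscerning t₁ t₂)
    (T : CategoryTheory.Monad (Type u)) [MonadPreservation.MonoidalMonad T] :
    MonadPreservation.IsRelevant T ↔ MonadPreservation.Preserves T t₁ t₂ := by
  rcases h with h | h
  · exact ⟨fun hT => hT.preserves h.vars_eq, fun hT => h.isRelevant hT⟩
  · exact ⟨fun hT => hT.preserves h.vars_eq.symm, fun hT => h.isRelevant hT.symm⟩
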